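/- For $r\in(0,1)$ write $r'=\sqrt{1-r^2}$. Let $\mathcal K(r)=\int_0^1\frac{dx}{\sqrt{(1-x^2)(1-r^2x^2)}}$ be the complete elliptic integral of the first kind, and let $$\mu(r)=\frac{\pi}{2}\,\frac{\mathcal K(r')}{\mathcal K(r)} .$$ Define the Landen sequences $L(r,p)$, $p\in\mathbb Z$, by $L(r,0)=r$ and, for $p=0,1,2,\dots$, $$L(r,p+1)=\frac{2\sqrt{L(r,p)}}{1+L(r,p)},\qquad L(r,-p-1)=\left(\frac{L(r,-p)}{1+\sqrt{1-L(r,-p)^2}}\right)^2 .$$ Then for every $0<r<1$ and every $p\in\mathbb Z$, $$2^{-p}\log\frac{1}{L(r,-p)}<\mu(r)<2^{-p}\log\frac{4}{L(r,-p)} .$$ In particular, for $p=1$, $$\log\frac{1+r'}{r}<\mu(r)<\log\frac{2(1+r')}{r}\qquad(0<r<1).$$ -/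

import Mathlib

/-- The ascending Landen sequence `L(r,0), L(r,1), L(r,2), …`. -/
noncomputable def landenAsc (r : ℝ) : ℕ → ℝ
  | 0 => r
  | p + 1 => 2 * Real.sqrt (landenAsc r p) / (1 + landenAsc r p)

/-- The descending Landen sequence `L(r,0), L(r,-1), L(r,-2), …`. -/
noncomputable def landenDesc (r : ℝ) : ℕ → ℝ
  | 0 => r
  | p + 1 => (landenDesc r p / (1 + Real.sqrt (1 - landenDesc r p ^ 2))) ^ 2

/-- The Landen sequence `L(r,p)` for an integer `p` (ascending for `p ≥ 0`,
descending for `p ≤ 0`). -/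
noncomputable def landen (r : ℝ) : ℤ → ℝ
  | Int.ofNat p => landenAsc r p
  | Int.negSucc p => landenDesc r (p + 1)

theorem landen_zero (r : ℝ) : landen r 0 = r := rfl

theorem landen_natCast (r : ℝ) (p : ℕ) : landen r (p : ℤ) = landenAsc r p := rfl

theorem landen_neg_natCast (r : ℝ) (p : ℕ) : landen r (-(p : ℤ)) = landenDesc r p := by
  cases p with
  | zero => rfl
  | succ p => rfl

theorem landen_succ (r : ℝ) (p : ℕ) :
    landen r ((p : ℤ) + 1) = 2 * Real.sqrt (landen r p) / (1 + landen r p) := rfl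

theorem landen_neg_succ (r : ℝ) (p : ℕ) :
    landen r (-(p : ℤ) - 1) =
      (landen r (-(p : ℤ)) / (1 + Real.sqrt (1 - landen r (-(p : ℤ)) ^ 2))) ^ 2 := by
  have h : (-(p : ℤ) - 1) = -((p + 1 : ℕ) : ℤ) := by push_cast; ring
  rw [h, landen_neg_natCast, landen_neg_natCast]
  rfl

/-- The complete elliptic integral of the first kind, with modulus `r`. -/
noncomputable def ellipticK (r : ℝ) : ℝ :=
  ∫ x in (0 : ℝ)..1, 1 / Real.sqrt ((1 - x ^ 2) * (1 - r ^ 2 * x ^ 2))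

/-- The function `μ(r) = (π / 2) · K(r') / K(r)` with `r' = √(1 - r²)`. -/
noncomputable def muFun (r : ℝ) : ℝ :=
  Real.pi / 2 * (ellipticK (Real.sqrt (1 - r ^ 2)) / ellipticK r)

/-!
Write `r' = √(1 - r²)`. Gauss' substitution `y = (1 + k) x / (1 + k x²)` in the integral defining
`K` gives Landen's identity `K(l) = (1 + k) K(k)` for `l = 2√k / (1 + k)`
(`ellipticK_landen`). Applied to the modulus `l' = (1 - k) / (1 + k)`, whose ascending Landen
transform is `k'`, it also gives `K(k') = 2 K(l') / (1 + k)`, and therefore `μ(k) = 2 μ(l)`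
(`muFun_landen`). Hence `μ(L(r,-p)) = 2^p μ(r)` for all integers `p`
(`two_zpow_mul_muFun_landen`), and it suffices to show `0 < μ(r) + log r < log 4` on `(0,1)`.

The function `f(r) = μ(r) + log r` satisfies `f(l) = f(k) / 2 + log (1 + l')`
(`muFun_add_log_landen`), and `0 < log (1 + l') < log 2`. So `0` and `log 4` are bounds for `f`
as soon as `f(rₙ) / 2ⁿ → 0` along the descending Landen sequence `rₙ`. This follows from the crude
estimate `|f(r)| ≤ 3 / r'` (`abs_muFun_add_log_le`), whose right-hand side decreases along that
sequence. The crude estimate comes from comparing the integrand of `K` with functions having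
elementary antiderivatives. One further application of the functional equation makes the bounds
strict.
-/

open MeasureTheory Set

/-! ### Elementary estimates for the elliptic integral -/

/-- The fundamental theorem of calculus for a nonnegative, possibly unbounded derivative on
`(0,1)`; integrability is automatic. -/
theorem intervalIntegrable_and_integral_of_deriv_nonneg {F f : ℝ → ℝ}
    (hc : ContinuousOn F (Icc 0 1)) (hd : ∀ x ∈ Ioo (0 : ℝ) 1, HasDerivAt F (f x) x)
    (hf : ∀ x ∈ Ioo (0 : ℝ) 1, 0 ≤ f x) :
    IntervalIntegrable f volume 0 1 ∧ ∫ x in (0 : ℝ)..1, f x = F 1 - F 0 := by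
  have hi : IntervalIntegrable f volume 0 1 :=
    (intervalIntegrable_iff_integrableOn_Ioc_of_le zero_le_one).2
      (intervalIntegral.integrableOn_deriv_of_nonneg hc hd hf)
  exact ⟨hi, intervalIntegral.integral_eq_sub_of_hasDerivAt_of_le zero_le_one hc hd hi⟩

theorem integral_inv_sqrt_one_sub_sq :
    IntervalIntegrable (fun x : ℝ => 1 / √(1 - x ^ 2)) volume 0 1 ∧
      ∫ x in (0 : ℝ)..1, 1 / √(1 - x ^ 2) = Real.pi / 2 := by
  have h := intervalIntegrable_and_integral_of_deriv_nonneg (F := Real.arcsin)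
    (f := fun x : ℝ => 1 / √(1 - x ^ 2)) Real.continuous_arcsin.continuousOn
    (fun x hx => Real.hasDerivAt_arcsin (by linarith [hx.1]) hx.2.ne)
    (fun x _ => by positivity)
  simpa using h

section Estimates

variable {r s x : ℝ}

theorem one_sub_sq_le_one_sub_mul_sq (h : r ^ 2 + s ^ 2 = 1) :
    1 - x ^ 2 ≤ 1 - s ^ 2 * x ^ 2 := by
  nlinarith [mul_nonneg (sq_nonneg r) (sq_nonneg x)]

theorem sq_le_one_sub_mul_sq (h : r ^ 2 + s ^ 2 = 1) (hx : x ∈ Ioo (0 : ℝ) 1) :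
    r ^ 2 ≤ 1 - s ^ 2 * x ^ 2 := by
  have : x ^ 2 ≤ 1 := by nlinarith [hx.1, hx.2]
  nlinarith [mul_nonneg (sq_nonneg s) (sub_nonneg.2 this)]

theorem one_sub_sq_pos_of_mem_Ioo (hx : x ∈ Ioo (0 : ℝ) 1) : 0 < 1 - x ^ 2 := by
  nlinarith [hx.1, hx.2]

theorem inv_sqrt_le_ellipticK_integrand (hr : 0 < r) (h : r ^ 2 + s ^ 2 = 1)
    (hx : x ∈ Ioo (0 : ℝ) 1) :
    1 / √(1 - x ^ 2) ≤ 1 / √((1 - x ^ 2) * (1 - s ^ 2 * x ^ 2)) := by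
  have h1 := one_sub_sq_pos_of_mem_Ioo hx
  have h2 : 0 < 1 - s ^ 2 * x ^ 2 := (pow_pos hr 2).trans_le (sq_le_one_sub_mul_sq h hx)
  apply one_div_le_one_div_of_le (Real.sqrt_pos.2 (mul_pos h1 h2))
  apply Real.sqrt_le_sqrt
  nlinarith [mul_nonneg h1.le (mul_nonneg (sq_nonneg s) (sq_nonneg x))]

theorem ellipticK_integrand_le (hr : 0 < r) (h : r ^ 2 + s ^ 2 = 1) (hx : x ∈ Ioo (0 : ℝ) 1) :
    1 / √((1 - x ^ 2) * (1 - s ^ 2 * x ^ 2)) ≤ 1 / r * (1 / √(1 - x ^ 2)) := by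
  have h1 := one_sub_sq_pos_of_mem_Ioo hx
  rw [Real.sqrt_mul h1.le, one_div_mul_one_div]
  have h3 : 0 < √(1 - x ^ 2) := Real.sqrt_pos.2 h1
  apply one_div_le_one_div_of_le (by positivity)
  rw [mul_comm]
  exact mul_le_mul_of_nonneg_left (Real.le_sqrt_of_sq_le (sq_le_one_sub_mul_sq h hx)) h3.le

theorem intervalIntegrable_ellipticK (hr : 0 < r) (h : r ^ 2 + s ^ 2 = 1) :
    IntervalIntegrable (fun x : ℝ => 1 / √((1 - x ^ 2) * (1 - s ^ 2 * x ^ 2))) volume 0 1 := by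
  have hg := integral_inv_sqrt_one_sub_sq.1.const_mul (1 / r)
  rw [intervalIntegrable_iff_integrableOn_Ioo_of_le zero_le_one] at hg ⊢
  refine hg.mono' (by measurability) ?_
  refine (ae_restrict_mem measurableSet_Ioo).mono fun x hx => ?_
  rw [Real.norm_of_nonneg (by positivity)]
  exact ellipticK_integrand_le hr h hx

theorem pi_div_two_le_ellipticK (hr : 0 < r) (h : r ^ 2 + s ^ 2 = 1) :
    Real.pi / 2 ≤ ellipticK s := by
  rw [← integral_inv_sqrt_one_sub_sq.2]
  exact intervalIntegral.integral_mono_on_of_le_Ioo zero_le_one integral_inv_sqrt_one_sub_sq.1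
    (intervalIntegrable_ellipticK hr h) fun x hx => inv_sqrt_le_ellipticK_integrand hr h hx

theorem ellipticK_pos (hr : 0 < r) (h : r ^ 2 + s ^ 2 = 1) : 0 < ellipticK s :=
  (half_pos Real.pi_pos).trans_le (pi_div_two_le_ellipticK hr h)

theorem ellipticK_le_pi_div (hr : 0 < r) (h : r ^ 2 + s ^ 2 = 1) :
    ellipticK s ≤ Real.pi / 2 / r := by
  have := intervalIntegral.integral_mono_on_of_le_Ioo zero_le_one
    (intervalIntegrable_ellipticK hr h) (integral_inv_sqrt_one_sub_sq.1.const_mul (1 / r))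
    fun x hx => ellipticK_integrand_le hr h hx
  rw [intervalIntegral.integral_const_mul, integral_inv_sqrt_one_sub_sq.2] at this
  exact this.trans_eq (by ring)

/-- The integrand of `K(s)` dominates `s² x / (1 - s² x²)`, the derivative of
`-log (1 - s² x²) / 2`. -/
theorem neg_log_le_ellipticK (hr : 0 < r) (h : r ^ 2 + s ^ 2 = 1) :
    -Real.log r ≤ ellipticK s := by
  have hpos : ∀ x ∈ Icc (0 : ℝ) 1, 0 < 1 - s ^ 2 * x ^ 2 := fun x hx => by
    have : x ^ 2 ≤ 1 := by nlinarith [hx.1, hx.2]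
    nlinarith [mul_nonneg (sq_nonneg s) (sub_nonneg.2 this), pow_pos hr 2]
  obtain ⟨hi, hv⟩ := intervalIntegrable_and_integral_of_deriv_nonneg
    (F := fun x : ℝ => -(1 / 2) * Real.log (1 - s ^ 2 * x ^ 2))
    (f := fun x : ℝ => s ^ 2 * x / (1 - s ^ 2 * x ^ 2))
    (ContinuousOn.mul continuousOn_const
      (ContinuousOn.log (by fun_prop) fun x hx => (hpos x hx).ne'))
    (fun x hx => by
      have hp := (hpos x (Ioo_subset_Icc_self hx)).ne'
      have h1 : HasDerivAt (fun x : ℝ => 1 - s ^ 2 * x ^ 2) (-(s ^ 2 * (2 * x))) x := by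
        simpa using ((hasDerivAt_pow 2 x).const_mul (s ^ 2)).const_sub 1
      convert! (h1.log hp).const_mul (-(1 / 2)) using 1
      field_simp)
    (fun x hx => div_nonneg (mul_nonneg (sq_nonneg s) hx.1.le)
      (hpos x (Ioo_subset_Icc_self hx)).le)
  have he : (1 : ℝ) - s ^ 2 * 1 ^ 2 = r ^ 2 := by linarith
  simp only [he, Real.log_pow] at hv
  norm_num at hv
  rw [show -Real.log r = -(1 / 2 * (2 * Real.log r)) by ring, ← hv]
  refine intervalIntegral.integral_mono_on_of_le_Ioo zero_le_one hi
    (intervalIntegrable_ellipticK hr h) fun x hx => ?_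
  have hp := hpos x (Ioo_subset_Icc_self hx)
  have hs : s ^ 2 ≤ 1 := by nlinarith [sq_nonneg r]
  have h1 := one_sub_sq_pos_of_mem_Ioo hx
  calc s ^ 2 * x / (1 - s ^ 2 * x ^ 2) ≤ 1 / (1 - s ^ 2 * x ^ 2) := by
        apply div_le_div_of_nonneg_right _ hp.le
        nlinarith [hx.1, hx.2]
    _ ≤ _ := by
        apply one_div_le_one_div_of_le (Real.sqrt_pos.2 (mul_pos h1 hp))
        rw [Real.sqrt_le_left hp.le, pow_two (1 - s ^ 2 * x ^ 2)]
        exact mul_le_mul_of_nonneg_right (one_sub_sq_le_one_sub_mul_sq h) hp.le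

/-- With `g` the integrand of `K(s)`, one has `(1 - x) g ≤ 1`, while `s x g` is the derivative of
`-arsinh (s √(1 - x²) / r)`. -/
theorem mul_ellipticK_le (hr : 0 < r) (hs : 0 < s) (h : r ^ 2 + s ^ 2 = 1) :
    s * ellipticK s ≤ 2 - Real.log r := by
  have hderiv : ∀ x ∈ Ioo (0 : ℝ) 1, HasDerivAt (fun x : ℝ => -Real.arsinh (s / r * √(1 - x ^ 2)))
      (s * x * (1 / √((1 - x ^ 2) * (1 - s ^ 2 * x ^ 2)))) x := fun x hx => by
    have h1 := one_sub_sq_pos_of_mem_Ioo hx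
    have h2 : 0 < 1 - s ^ 2 * x ^ 2 := (pow_pos hr 2).trans_le (sq_le_one_sub_mul_sq h hx)
    have hd : HasDerivAt (fun x : ℝ => 1 - x ^ 2) (-(2 * x)) x := by
      simpa using (hasDerivAt_pow 2 x).const_sub 1
    have hu : 1 + (s / r * √(1 - x ^ 2)) ^ 2 = (1 - s ^ 2 * x ^ 2) / r ^ 2 := by
      rw [mul_pow, Real.sq_sqrt h1.le]
      field_simp
      linarith
    have hd' := ((hd.sqrt h1.ne').const_mul (s / r)).arsinh.neg
    refine hd'.congr_deriv ?_
    rw [hu, Real.sqrt_div h2.le, Real.sqrt_sq hr.le, Real.sqrt_mul h1.le, smul_eq_mul]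
    have := Real.sqrt_pos.2 h1
    have := Real.sqrt_pos.2 h2
    field_simp
  have hcont : ContinuousOn (fun x : ℝ => -Real.arsinh (s / r * √(1 - x ^ 2))) (Icc 0 1) :=
    (Real.continuous_arsinh.comp (by fun_prop)).neg.continuousOn
  obtain ⟨hi, hv⟩ := intervalIntegrable_and_integral_of_deriv_nonneg hcont hderiv
    fun x hx => mul_nonneg (mul_nonneg hs.le hx.1.le) (by positivity)
  have hval : Real.arsinh (s / r) = Real.log (1 + s) - Real.log r := by
    have : 1 + (s / r) ^ 2 = (1 / r) ^ 2 := by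
      field_simp
      linarith
    rw [Real.arsinh, this, Real.sqrt_sq (by positivity), ← Real.log_div (by positivity) hr.ne']
    congr 1
    ring
  norm_num [hval] at hv
  have hle : ∀ x ∈ Ioo (0 : ℝ) 1, s * (1 / √((1 - x ^ 2) * (1 - s ^ 2 * x ^ 2)))
      ≤ s + s * x * (1 / √((1 - x ^ 2) * (1 - s ^ 2 * x ^ 2))) := fun x hx => by
    have h1 := one_sub_sq_pos_of_mem_Ioo hx
    have h2 := one_sub_sq_le_one_sub_mul_sq (x := x) h
    have h3 : 1 - x ≤ √((1 - x ^ 2) * (1 - s ^ 2 * x ^ 2)) := by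
      apply Real.le_sqrt_of_sq_le
      have h4 : 1 - x ≤ 1 - x ^ 2 := by nlinarith [hx.1, hx.2]
      have h5 : (1 - x) ^ 2 ≤ (1 - x ^ 2) ^ 2 := pow_le_pow_left₀ (by linarith [hx.2]) h4 2
      nlinarith
    have h4 : (1 - x) * (1 / √((1 - x ^ 2) * (1 - s ^ 2 * x ^ 2))) ≤ 1 := by
      rw [mul_one_div]
      exact div_le_one_of_le₀ h3 (Real.sqrt_nonneg _)
    nlinarith
  have hc : IntervalIntegrable (fun _ : ℝ => s) volume 0 1 := intervalIntegrable_const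
  have hK := intervalIntegral.integral_mono_on_of_le_Ioo zero_le_one
    ((intervalIntegrable_ellipticK hr h).const_mul s) (hc.add hi) hle
  rw [intervalIntegral.integral_const_mul, intervalIntegral.integral_add hc hi,
    intervalIntegral.integral_const] at hK
  norm_num [hv] at hK
  have hs1 : s ≤ 1 := by nlinarith [sq_nonneg r]
  have hl : Real.log (1 + s) ≤ s := by
    linarith [Real.log_le_sub_one_of_pos (show 0 < 1 + s by linarith)]
  unfold ellipticK
  norm_num
  linarith

end Estimates

/-! ### Landen's transformation -/

/-- Gauss' change of variables `y = (1 + k) x / (1 + k x²)`, which maps `(0,1)` increasingly onto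
itself. -/
theorem ellipticK_landen {k : ℝ} (hk0 : 0 < k) (hk1 : k < 1) :
    ellipticK (2 * √k / (1 + k)) = (1 + k) * ellipticK k := by
  set φ : ℝ → ℝ := fun x => (1 + k) * x / (1 + k * x ^ 2) with hφ
  have hD : ∀ x : ℝ, 0 < 1 + k * x ^ 2 := fun x => by positivity
  have hkx : ∀ x ∈ Ioo (0 : ℝ) 1, 0 < 1 - k * x ^ 2 := fun x hx => by
    nlinarith [one_sub_sq_pos_of_mem_Ioo hx]
  have hderiv : ∀ x ∈ Ioo (0 : ℝ) 1, HasDerivWithinAt φ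
      ((1 + k) * (1 - k * x ^ 2) / (1 + k * x ^ 2) ^ 2) (Ioo 0 1) x := fun x _ => by
    have h1 : HasDerivAt (fun x : ℝ => 1 + k * x ^ 2) (k * (2 * x)) x := by
      simpa using ((hasDerivAt_pow 2 x).const_mul k).const_add 1
    have h2 : HasDerivAt (fun x : ℝ => (1 + k) * x) (1 + k) x := by
      simpa using (hasDerivAt_id x).const_mul (1 + k)
    convert! (h2.div h1 (hD x).ne').hasDerivWithinAt using 1
    ring
  have hmono : MonotoneOn φ (Ioo 0 1) := fun a ha b hb hab => by
    show (1 + k) * a / (1 + k * a ^ 2) ≤ (1 + k) * b / (1 + k * b ^ 2)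
    rw [div_le_div_iff₀ (hD a) (hD b)]
    have hab1 : a * b < 1 := by nlinarith [ha.1, ha.2, hb.1, hb.2]
    have hkab : k * (a * b) < 1 := by nlinarith [mul_pos ha.1 hb.1]
    nlinarith [mul_nonneg (mul_nonneg (sub_nonneg.2 hab) (sub_nonneg.2 hkab.le))
      (show 0 ≤ 1 + k by linarith)]
  have himage : φ '' Ioo 0 1 = Ioo 0 1 := by
    apply Subset.antisymm
    · rintro _ ⟨x, hx, rfl⟩
      refine ⟨div_pos (mul_pos (by linarith) hx.1) (hD x), ?_⟩
      rw [hφ, div_lt_one (hD x)]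
      nlinarith [mul_pos (sub_pos.2 hx.2) (show 0 < 1 - k * x by nlinarith [hx.1, hx.2])]
    · have hc : ContinuousOn φ (Icc 0 1) :=
        ContinuousOn.div (by fun_prop) (by fun_prop) fun x _ => (hD x).ne'
      have h01 := intermediate_value_Ioo zero_le_one hc
      have e0 : φ 0 = 0 := by simp [hφ]
      have e1 : φ 1 = 1 := by
        simp only [hφ, mul_one, one_pow]
        exact div_self (by linarith)
      rwa [e0, e1] at h01
  unfold ellipticK
  rw [intervalIntegral.integral_of_le zero_le_one, intervalIntegral.integral_of_le zero_le_one,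
    integral_Ioc_eq_integral_Ioo, integral_Ioc_eq_integral_Ioo, ← integral_const_mul,
    ← himage, integral_image_eq_integral_deriv_smul_of_monotoneOn measurableSet_Ioo hderiv hmono,
    himage]
  refine setIntegral_congr_fun measurableSet_Ioo fun x hx => ?_
  have hDx := hD x
  have hl : (2 * √k / (1 + k)) ^ 2 = 4 * k / (1 + k) ^ 2 := by
    rw [div_pow, mul_pow, Real.sq_sqrt hk0.le]
    ring
  have hfac : (1 - φ x ^ 2) * (1 - (2 * √k / (1 + k)) ^ 2 * φ x ^ 2)
      = ((1 - x ^ 2) * (1 - k ^ 2 * x ^ 2)) * ((1 - k * x ^ 2) / (1 + k * x ^ 2) ^ 2) ^ 2 := by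
    rw [hl, hφ]
    have : (1 + k) ≠ 0 := by linarith
    field_simp
    ring
  have hq : 0 < (1 - k * x ^ 2) / (1 + k * x ^ 2) ^ 2 := div_pos (hkx x hx) (by positivity)
  have hrad : 0 < (1 - x ^ 2) * (1 - k ^ 2 * x ^ 2) := by
    apply mul_pos (one_sub_sq_pos_of_mem_Ioo hx)
    nlinarith [hkx x hx, mul_pos hk0 (mul_pos (sub_pos.2 hk1) (pow_pos hx.1 2))]
  have hsq := Real.sqrt_pos.2 hrad
  show ((1 + k) * (1 - k * x ^ 2) / (1 + k * x ^ 2) ^ 2) •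
    (1 / √((1 - φ x ^ 2) * (1 - (2 * √k / (1 + k)) ^ 2 * φ x ^ 2))) = _
  rw [hfac, Real.sqrt_mul hrad.le, Real.sqrt_sq hq.le, smul_eq_mul]
  have := hkx x hx
  field_simp

theorem sqrt_one_sub_sq_mem_Ioo {r : ℝ} (hr : r ∈ Ioo (0 : ℝ) 1) :
    √(1 - r ^ 2) ∈ Ioo (0 : ℝ) 1 := by
  refine ⟨Real.sqrt_pos.2 (one_sub_sq_pos_of_mem_Ioo hr), ?_⟩
  rw [Real.sqrt_lt' one_pos]
  nlinarith [hr.1]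

theorem sq_add_sqrt_one_sub_sq_sq {r : ℝ} (hr : r ∈ Ioo (0 : ℝ) 1) :
    r ^ 2 + √(1 - r ^ 2) ^ 2 = 1 := by
  rw [Real.sq_sqrt (one_sub_sq_pos_of_mem_Ioo hr).le]
  ring

theorem ascending_mem_Ioo {k : ℝ} (hk : k ∈ Ioo (0 : ℝ) 1) :
    2 * √k / (1 + k) ∈ Ioo (0 : ℝ) 1 := by
  have h0 := Real.sqrt_pos.2 hk.1
  have h1 : √k < 1 := by simpa using (Real.sqrt_lt' one_pos).2 (by simpa using hk.2)
  have h2 := Real.sq_sqrt hk.1.le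
  refine ⟨div_pos (by linarith) (by linarith [hk.1]), ?_⟩
  rw [div_lt_one (by linarith [hk.1])]
  nlinarith [pow_pos (sub_pos.2 h1) 2]

/-- The complementary modulus of `2√k / (1 + k)`. -/
theorem sqrt_one_sub_ascending_sq {k : ℝ} (hk : k ∈ Ioo (0 : ℝ) 1) :
    √(1 - (2 * √k / (1 + k)) ^ 2) = (1 - k) / (1 + k) := by
  have h1 : 0 < 1 + k := by linarith [hk.1]
  have : 1 - (2 * √k / (1 + k)) ^ 2 = ((1 - k) / (1 + k)) ^ 2 := by
    rw [div_pow, mul_pow, Real.sq_sqrt hk.1.le]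
    field_simp
    ring
  rw [this, Real.sqrt_sq (div_nonneg (by linarith [hk.2]) h1.le)]

theorem muFun_landen {k : ℝ} (hk : k ∈ Ioo (0 : ℝ) 1) :
    muFun k = 2 * muFun (2 * √k / (1 + k)) := by
  have h1 : 0 < 1 + k := by linarith [hk.1]
  set m := (1 - k) / (1 + k) with hm
  have hm0 : 0 < m := div_pos (by linarith [hk.2]) h1
  have hm1 : m < 1 := by
    rw [hm, div_lt_one h1]
    linarith [hk.1]
  -- The ascending transform of `m` is the complementary modulus of `k`.
  have hasc : 2 * √m / (1 + m) = √(1 - k ^ 2) := by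
    symm
    rw [Real.sqrt_eq_iff_eq_sq (one_sub_sq_pos_of_mem_Ioo hk).le (by positivity), div_pow, mul_pow,
      Real.sq_sqrt hm0.le, hm]
    field_simp
    ring
  have hKm := ellipticK_landen hm0 hm1
  rw [hasc] at hKm
  have hmk : 1 + m = 2 / (1 + k) := by
    rw [hm]
    field_simp
    ring
  have hKk : ellipticK k ≠ 0 := (ellipticK_pos (sqrt_one_sub_sq_mem_Ioo hk).1
    (by rw [add_comm]; exact sq_add_sqrt_one_sub_sq_sq hk)).ne'
  unfold muFun
  rw [sqrt_one_sub_ascending_sq hk, ← hm, hKm, hmk, ellipticK_landen hk.1 hk.2]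
  field_simp

theorem descending_mem_Ioo {r : ℝ} (hr : r ∈ Ioo (0 : ℝ) 1) :
    (r / (1 + √(1 - r ^ 2))) ^ 2 ∈ Ioo (0 : ℝ) 1 := by
  have hs := (sqrt_one_sub_sq_mem_Ioo hr).1
  have h0 : 0 < r / (1 + √(1 - r ^ 2)) := div_pos hr.1 (by linarith)
  have h1 : r / (1 + √(1 - r ^ 2)) < 1 := (div_lt_one (by linarith)).2 (by linarith [hr.2])
  exact ⟨pow_pos h0 2, pow_lt_one₀ h0.le h1 two_ne_zero⟩

/-- The ascending Landen transformation inverts the descending one. -/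
theorem ascending_descending {r : ℝ} (hr : r ∈ Ioo (0 : ℝ) 1) :
    2 * √((r / (1 + √(1 - r ^ 2))) ^ 2) / (1 + (r / (1 + √(1 - r ^ 2))) ^ 2) = r := by
  have hs := (sqrt_one_sub_sq_mem_Ioo hr).1
  have hrs := sq_add_sqrt_one_sub_sq_sq hr
  have h0 := hr.1
  generalize √(1 - r ^ 2) = s at *
  rw [Real.sqrt_sq (by positivity)]
  field_simp
  linear_combination (-1 : ℝ) * hrs

/-! ### Bounds for `μ(r) + log r` -/

theorem muFun_add_log_landen {k : ℝ} (hk : k ∈ Ioo (0 : ℝ) 1) :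
    muFun (2 * √k / (1 + k)) + Real.log (2 * √k / (1 + k)) =
      (muFun k + Real.log k) / 2 + Real.log (1 + √(1 - (2 * √k / (1 + k)) ^ 2)) := by
  have h1 : 0 < 1 + k := by linarith [hk.1]
  have h2 : 1 + (1 - k) / (1 + k) = 2 / (1 + k) := by
    field_simp
    ring
  have h3 := Real.sqrt_pos.2 hk.1
  rw [sqrt_one_sub_ascending_sq hk, muFun_landen hk, h2, Real.log_div (by positivity) h1.ne',
    Real.log_div two_ne_zero h1.ne', Real.log_mul two_ne_zero h3.ne', Real.log_sqrt hk.1.le]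
  ring

/-- The functional equation in descending form. -/
theorem muFun_add_log_eq_descending {r : ℝ} (hr : r ∈ Ioo (0 : ℝ) 1) :
    muFun r + Real.log r =
      (muFun ((r / (1 + √(1 - r ^ 2))) ^ 2) + Real.log ((r / (1 + √(1 - r ^ 2))) ^ 2)) / 2 +
        Real.log (1 + √(1 - r ^ 2)) := by
  have h := muFun_add_log_landen (descending_mem_Ioo hr)
  rwa [ascending_descending hr] at h

theorem abs_muFun_add_log_le {r : ℝ} (hr : r ∈ Ioo (0 : ℝ) 1) :
    |muFun r + Real.log r| ≤ 3 / √(1 - r ^ 2) := by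
  obtain ⟨hs0, hs1⟩ := sqrt_one_sub_sq_mem_Ioo hr
  have hrs := sq_add_sqrt_one_sub_sq_sq hr
  have hsr : √(1 - r ^ 2) ^ 2 + r ^ 2 = 1 := by linarith
  unfold muFun
  generalize √(1 - r ^ 2) = s at *
  have hr0 := hr.1
  have hKr := ellipticK_pos hs0 hsr
  have hKs := ellipticK_pos hr0 hrs
  have hlo := neg_log_le_ellipticK hr0 hrs
  have hup := mul_ellipticK_le hr0 hs0 hrs
  -- `s K(s) ≤ μ(r) ≤ K(s)`, since `π / 2 ≤ K(r) ≤ π / (2 s)`.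
  have hμup : Real.pi / 2 * (ellipticK s / ellipticK r) ≤ ellipticK s := by
    rw [← mul_div_assoc, div_le_iff₀ hKr, mul_comm]
    exact mul_le_mul_of_nonneg_left (pi_div_two_le_ellipticK hs0 hsr) hKs.le
  have hμlo : s * ellipticK s ≤ Real.pi / 2 * (ellipticK s / ellipticK r) := by
    rw [← mul_div_assoc, le_div_iff₀ hKr]
    have := (le_div_iff₀ hs0).1 (ellipticK_le_pi_div hs0 hsr)
    nlinarith
  generalize Real.pi / 2 * (ellipticK s / ellipticK r) = M at *
  have hlog0 : Real.log r < 0 := Real.log_neg hr0 hr.2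
  -- `(1 - s) log (1 / r) ≤ r² log (1 / r) ≤ 1`.
  have hsmall : (1 - s) * -Real.log r ≤ 1 := by
    have h1 : 1 - s ≤ r ^ 2 := by nlinarith
    have h2 : -Real.log r ≤ 1 / r := by
      have := Real.log_le_sub_one_of_pos (show 0 < 1 / r by positivity)
      rw [one_div, Real.log_inv] at this
      rw [one_div]
      linarith
    have h3 : r ^ 2 * (1 / r) = r := by
      field_simp
    calc (1 - s) * -Real.log r ≤ r ^ 2 * (1 / r) :=
          mul_le_mul h1 h2 (by linarith) (sq_nonneg r)
      _ ≤ 1 := by rw [h3]; exact hr.2.le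
  rw [abs_le]
  constructor
  · have : 3 ≤ 3 / s := by
      rw [le_div_iff₀ hs0]
      linarith
    nlinarith
  · rw [le_div_iff₀ hs0]
    nlinarith

theorem sqrt_one_sub_sq_le_descending {r : ℝ} (hr : r ∈ Ioo (0 : ℝ) 1) :
    √(1 - r ^ 2) ≤ √(1 - ((r / (1 + √(1 - r ^ 2))) ^ 2) ^ 2) := by
  have hs := (sqrt_one_sub_sq_mem_Ioo hr).1
  have h0 : 0 ≤ r / (1 + √(1 - r ^ 2)) := div_nonneg hr.1.le (by linarith)
  have h1 : r / (1 + √(1 - r ^ 2)) ≤ r := div_le_self hr.1.le (by linarith)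
  have h2 : (r / (1 + √(1 - r ^ 2))) ^ 2 ≤ r := by nlinarith [hr.2]
  exact Real.sqrt_le_sqrt (by linarith [pow_le_pow_left₀ (sq_nonneg _) h2 2])

/-- The crude bound, improved by `n` applications of the functional equation. -/
theorem muFun_add_log_bounds_iterate (n : ℕ) {r : ℝ} (hr : r ∈ Ioo (0 : ℝ) 1) :
    -(3 / √(1 - r ^ 2)) * (1 / 2) ^ n ≤ muFun r + Real.log r ∧
      muFun r + Real.log r ≤ 2 * Real.log 2 + 3 / √(1 - r ^ 2) * (1 / 2) ^ n := by
  induction n generalizing r with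
  | zero =>
    have := abs_le.1 (abs_muFun_add_log_le hr)
    have h2 := Real.log_pos one_lt_two
    constructor <;> linarith
  | succ n ih =>
    obtain ⟨h1, h2⟩ := ih (descending_mem_Ioo hr)
    obtain ⟨hs0, hs1⟩ := sqrt_one_sub_sq_mem_Ioo hr
    have h3 := div_le_div_of_nonneg_left (zero_le_three (α := ℝ)) hs0
      (sqrt_one_sub_sq_le_descending hr)
    have h4 := mul_le_mul_of_nonneg_right h3 (show (0 : ℝ) ≤ (1 / 2) ^ n by positivity)
    have h5 : 0 < Real.log (1 + √(1 - r ^ 2)) := Real.log_pos (by linarith)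
    have h6 : Real.log (1 + √(1 - r ^ 2)) < Real.log 2 :=
      Real.log_lt_log (by linarith) (by linarith)
    rw [muFun_add_log_eq_descending hr, pow_succ (1 / 2 : ℝ) n]
    constructor <;> linarith

theorem muFun_add_log_mem_Icc {r : ℝ} (hr : r ∈ Ioo (0 : ℝ) 1) :
    muFun r + Real.log r ∈ Icc 0 (2 * Real.log 2) := by
  have ht : Filter.Tendsto (fun n : ℕ => (1 / 2 : ℝ) ^ n) Filter.atTop (nhds 0) :=
    tendsto_pow_atTop_nhds_zero_of_lt_one (by norm_num) (by norm_num)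
  have hlo := ht.const_mul (-(3 / √(1 - r ^ 2)))
  have hup := (ht.const_mul (3 / √(1 - r ^ 2))).const_add (2 * Real.log 2)
  rw [mul_zero] at hlo hup
  rw [add_zero] at hup
  exact ⟨le_of_tendsto' hlo fun n => (muFun_add_log_bounds_iterate n hr).1,
    ge_of_tendsto' hup fun n => (muFun_add_log_bounds_iterate n hr).2⟩

theorem log_one_div_lt_muFun_lt {r : ℝ} (hr : r ∈ Ioo (0 : ℝ) 1) :
    Real.log (1 / r) < muFun r ∧ muFun r < Real.log (4 / r) := by
  obtain ⟨h1, h2⟩ := muFun_add_log_mem_Icc (descending_mem_Ioo hr)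
  obtain ⟨hs0, hs1⟩ := sqrt_one_sub_sq_mem_Ioo hr
  have h5 : 0 < Real.log (1 + √(1 - r ^ 2)) := Real.log_pos (by linarith)
  have h6 : Real.log (1 + √(1 - r ^ 2)) < Real.log 2 :=
    Real.log_lt_log (by linarith) (by linarith)
  have h7 := muFun_add_log_eq_descending hr
  have h8 : Real.log 4 = 2 * Real.log 2 := by
    rw [show (4 : ℝ) = 2 ^ 2 by norm_num, Real.log_pow]
    norm_num
  rw [Real.log_div one_ne_zero hr.1.ne', Real.log_div four_ne_zero hr.1.ne', Real.log_one, h8]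
  constructor <;> linarith

/-! ### The Landen sequences -/

theorem landenAsc_mem_and_muFun {r : ℝ} (hr : r ∈ Ioo (0 : ℝ) 1) (n : ℕ) :
    landenAsc r n ∈ Ioo (0 : ℝ) 1 ∧ muFun r = 2 ^ n * muFun (landenAsc r n) := by
  induction n with
  | zero => exact ⟨hr, by simp [landenAsc]⟩
  | succ n ih =>
    refine ⟨ascending_mem_Ioo ih.1, ?_⟩
    rw [ih.2, muFun_landen ih.1, landenAsc]
    ring

theorem landenDesc_mem_and_muFun {r : ℝ} (hr : r ∈ Ioo (0 : ℝ) 1) (n : ℕ) :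
    landenDesc r n ∈ Ioo (0 : ℝ) 1 ∧ muFun (landenDesc r n) = 2 ^ n * muFun r := by
  induction n with
  | zero => exact ⟨hr, by simp [landenDesc]⟩
  | succ n ih =>
    have hd := descending_mem_Ioo ih.1
    refine ⟨hd, ?_⟩
    rw [landenDesc, muFun_landen hd, ascending_descending ih.1, ih.2]
    ring

theorem two_zpow_mul_muFun_landen {r : ℝ} (hr : r ∈ Ioo (0 : ℝ) 1) (p : ℤ) :
    landen r p ∈ Ioo (0 : ℝ) 1 ∧ (2 : ℝ) ^ p * muFun (landen r p) = muFun r := by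
  obtain ⟨n, rfl | rfl⟩ := p.eq_nat_or_neg
  · obtain ⟨h1, h2⟩ := landenAsc_mem_and_muFun hr n
    rw [landen_natCast, zpow_natCast]
    exact ⟨h1, h2.symm⟩
  · obtain ⟨h1, h2⟩ := landenDesc_mem_and_muFun hr n
    rw [landen_neg_natCast, zpow_neg, zpow_natCast, h2]
    refine ⟨h1, ?_⟩
    field_simp

theorem mainTheorem2 (r : ℝ) (hr0 : 0 < r) (hr1 : r < 1) :
    (∀ p : ℤ,
      (2 : ℝ) ^ (-p) * Real.log (1 / landen r (-p)) < muFun r ∧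
        muFun r < (2 : ℝ) ^ (-p) * Real.log (4 / landen r (-p))) ∧
    Real.log ((1 + Real.sqrt (1 - r ^ 2)) / r) < muFun r ∧
      muFun r < Real.log (2 * (1 + Real.sqrt (1 - r ^ 2)) / r) := by
  have hr : r ∈ Ioo (0 : ℝ) 1 := ⟨hr0, hr1⟩
  have key : ∀ p : ℤ,
      (2 : ℝ) ^ (-p) * Real.log (1 / landen r (-p)) < muFun r ∧
        muFun r < (2 : ℝ) ^ (-p) * Real.log (4 / landen r (-p)) := fun p => by
    obtain ⟨hmem, hμ⟩ := two_zpow_mul_muFun_landen hr (-p)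
    have h2 : (0 : ℝ) < 2 ^ (-p) := by positivity
    rw [← hμ]
    exact ⟨mul_lt_mul_of_pos_left (log_one_div_lt_muFun_lt hmem).1 h2,
      mul_lt_mul_of_pos_left (log_one_div_lt_muFun_lt hmem).2 h2⟩
  refine ⟨key, ?_⟩
  have hs := (sqrt_one_sub_sq_mem_Ioo hr).1
  have h1 := key 1
  have hL : landen r (-1) = (r / (1 + √(1 - r ^ 2))) ^ 2 := rfl
  rw [hL] at h1
  have e1 : 1 / (r / (1 + √(1 - r ^ 2))) ^ 2 = ((1 + √(1 - r ^ 2)) / r) ^ 2 := by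
    field_simp
  have e2 : 4 / (r / (1 + √(1 - r ^ 2))) ^ 2 = (2 * (1 + √(1 - r ^ 2)) / r) ^ 2 := by
    field_simp
    norm_num
  rw [e1, e2, Real.log_pow, Real.log_pow, zpow_neg_one] at h1
  push_cast at h1
  constructor <;> linarith [h1.1, h1.2]
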